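/- Let $\widehat{\mathbb Z}=\prod_p \mathbb Z_p$ be the ring of profinite integers. For $\tau=(\tau_p)_p\in\widehat{\mathbb Z}$ and $f\in\mathbb Q[x]$ write $f(\tau)=(f(\tau_p))_p\in\prod_p\mathbb Q_p$, and let $R_\tau=\{f\in\mathbb Q[x] : f(\tau)\in\widehat{\mathbb Z}\}$, a subring of $\mathbb Q[x]$ ordered by $f<g$ if and only if $g-f$ has positive leading coefficient. A prime element of $R_\tau$ is called non-standard if it is a non-constant polynomial. Let $\mathcal D$ be any set of nonempty finite strictly increasing sequences $d=(d_1,\dots,d_l)$ of positive integers such that, for every prime number $p$, the residue classes of $0,d_1,\dots,d_l$ modulo $p$ do not exhaust $\mathbb Z/p\mathbb Z$. Then there exists $\tau\in\widehat{\mathbb Z}$ such that $R_\tau$ is a principal ideal domain and there are, for each $d\in\mathcal D$, elements $f_{d,0},f_{d,1},f_{d,2},\dots$ of $R_\tau$ with the following properties. (i) For each $d=(d_1,\dots,d_l)\in\mathcal D$ and each $n$, all terms of the progression $(f_{d,n},f_{d,n}+d_1,\dots,f_{d,n}+d_l)$ are positive prime elements of $R_\tau$, and the sequence $(f_{d,n})_n$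 is cofinal in $R_\tau$, i.e. for every $b\in R_\tau$ there is an $n$ with $b\le f_{d,n}$. (ii) For each positive non-standard prime $g$ of $R_\tau$, either $g$ is a term of one of the progressions in (i) (for some $d\in\mathcal D$ and some $n$), or there is no prime element $h\neq g$ of $R_\tau$ such that $g-h\in\mathbb Z$. -/

import Mathlib

noncomputable section

namespace ProfinitePID

instance factPrime (p : Nat.Primes) : Fact (Nat.Prime (p : ℕ)) := ⟨p.2⟩

/-- Profinite integers: the product of the rings of `p`-adic integers over all primes `p`. -/
abbrev ProfiniteInt : Type := (p : Nat.Primes) → ℤ_[(p : ℕ)]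

/-- The embedding of the profinite integers into the product of all the fields `ℚ_p`. -/
def embed : ProfiniteInt →+* ((p : Nat.Primes) → ℚ_[(p : ℕ)]) :=
  RingHom.pi fun p : Nat.Primes =>
    (PadicInt.Coe.ringHom (p := (p : ℕ))).comp
      (Pi.evalRingHom (fun q : Nat.Primes => ℤ_[(q : ℕ)]) p)

/-- The substitution homomorphism `f ↦ f(τ) = (f(τ_p))_p`. Its values are finite adeles; they are
regarded here as elements of the full product of the fields `ℚ_p`. -/
def substHom (τ : ProfiniteInt) : Polynomial ℚ →+* ((p : Nat.Primes) → ℚ_[(p : ℕ)]) :=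
  RingHom.pi fun p : Nat.Primes =>
    (Polynomial.aeval (R := ℚ) ((τ p : ℤ_[(p : ℕ)]) : ℚ_[(p : ℕ)])).toRingHom

/-- The ring `R_τ` of all `f ∈ ℚ[x]` such that `f(τ)` is a profinite integer. -/
def ringR (τ : ProfiniteInt) : Subring (Polynomial ℚ) :=
  embed.range.comap (substHom τ)

theorem mem_ringR (τ : ProfiniteInt) (f : Polynomial ℚ) :
    f ∈ ringR τ ↔
      ∀ p : Nat.Primes,
        ‖Polynomial.aeval (R := ℚ) ((τ p : ℤ_[(p : ℕ)]) : ℚ_[(p : ℕ)]) f‖ ≤ 1 := by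
  constructor
  · rintro ⟨z, hz⟩ p
    have h : ((z p : ℤ_[(p : ℕ)]) : ℚ_[(p : ℕ)]) =
        Polynomial.aeval (R := ℚ) ((τ p : ℤ_[(p : ℕ)]) : ℚ_[(p : ℕ)]) f := congrFun hz p
    rw [← h]
    exact (z p).2
  · intro h
    exact ⟨fun p => ⟨_, h p⟩, rfl⟩

/-- The canonical linear order of `ℚ[x]` restricted to `R_τ`: `f ≤ g` if and only if `g - f` is
zero or has positive leading coefficient. -/
def OrdLE {τ : ProfiniteInt} (f g : ringR τ) : Prop :=
  0 ≤ ((g : Polynomial ℚ) - (f : Polynomial ℚ)).leadingCoeff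

/-- Positivity for the canonical order of `R_τ`. -/
def IsPositive {τ : ProfiniteInt} (f : ringR τ) : Prop :=
  0 < (f : Polynomial ℚ).leadingCoeff

/-- A prime of `R_τ` is non-standard if it is a non-constant polynomial. -/
def IsNonstandardPrime {τ : ProfiniteInt} (f : ringR τ) : Prop :=
  Prime f ∧ 0 < (f : Polynomial ℚ).natDegree

/-- Nonempty finite strictly increasing sequences `d_1 < ... < d_l` of positive integers such that,
for each prime `p`, the classes of `0, d_1, ..., d_l` miss some residue class modulo `p`. -/
def AdmissibleSeq : Set (List ℕ) :=
  {d | d ≠ [] ∧ d.Pairwise (· < ·) ∧ (∀ e ∈ d, 0 < e) ∧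
    ∀ p : ℕ, p.Prime → ∃ r : ZMod p, ∀ e ∈ 0 :: d, (e : ZMod p) ≠ r}

/-- The set of members `f, f + d_1, ..., f + d_l` of the progression given by `f` and `d`. -/
def progression {τ : ProfiniteInt} (f : ringR τ) (d : List ℕ) : Set (ringR τ) :=
  {g | ∃ e ∈ 0 :: d, g = f + (e : ringR τ)}

/-- `(f, f + d_1, ..., f + d_l)` consists of positive primes of `R_τ`. -/
def IsPrimeProgression {τ : ProfiniteInt} (f : ringR τ) (d : List ℕ) : Prop :=
  ∀ g ∈ progression f d, Prime g ∧ IsPositive g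

end ProfinitePID

end

/-!
Call `τ` *almost unit* if every nonzero `q ∈ ℚ[x]` has nonzero values at all `τ_p`, and values of
norm `1` at almost all of them. Then every nonzero `q` has a rational multiple, unique up to sign,
whose value at `τ` is a unit of the profinite integers: its normalization. A nonconstant element of
`R_τ` is prime if and only if it is normalized and irreducible over `ℚ`. An ideal `I ≠ 0` of `R_τ` is
generated by `m * f`, where `f` is the normalized generator of the extension of `I` to `ℚ[x]` and
`m` is a positive integer, because `R_τ / m R_τ = ℤ / m ℤ`. So `R_τ` is a principal ideal domain, and
its positive non-standard primes are the positive normalizations of the irreducible polynomials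
(`IsAlmostUnit.isPrincipalIdealRing`, `IsAlmostUnit.irreducible_of_prime`, `prime_of_irreducible`).

It remains to choose `τ`. Each `τ_p` is taken transcendental with a prescribed residue modulo `p`, so
only the residues matter. They are chosen in stages (`Tower`); at each stage the residues at finitely
many primes are fixed in such a way that all polynomials treated before stay units there, and one
polynomial or one progression is treated.

* A progression with differences `d` is treated (`Stage.Valid.exists_isProgressionStep`) by choosing
  `F = K! x ^ k + c` of degree larger than all that came before. By admissibility of `d` and the
  Chinese remainder theorem, `c` can be chosen such that all `F + e`, for `e` in `0, d_1, ..., d_l`,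
  are units modulo each prime `p ≤ K`, whatever `τ_p` is, and are Eisenstein polynomials at suitable
  primes larger than `K`. At the primes larger than `K` there is enough room to avoid their roots.
  Thus the `F + e` are irreducible and normalized, so they are primes of `R_τ`.
* Any other irreducible polynomial `g` is treated (`Stage.Valid.exists_isSeparatingStep`) by making
  one large new prime `p` divide `g(τ_p)`. Then `p` divides the denominator of the leading
  coefficient of the normalization of `g`, whereas it does not occur in the leading coefficients of
  the normalizations of the polynomials treated before (`Tower.IsLimit.leadingCoeff_ne`). Hence the
  normalization of `g` is not a translate of an earlier prime by an integer. It is not a translate of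
  a later one either: the later one is a separated polynomial itself, or has larger degree.
-/

open Polynomial

namespace ProfinitePID

/-! ### Integer polynomials and their values modulo primes -/

theorem exists_map_eq_C_mul (q : ℚ[X]) :
    ∃ b : ℤ, b ≠ 0 ∧ ∃ u : ℤ[X], u.map (Int.castRingHom ℚ) = C (b : ℚ) * q := by
  obtain ⟨b, hb, h⟩ :=
    IsLocalization.integerNormalization_spec (nonZeroDivisors ℤ) (S := ℚ) q
  refine ⟨b, nonZeroDivisors.ne_zero hb,
    IsLocalization.integerNormalization (nonZeroDivisors ℤ) q, ?_⟩
  rw [← Polynomial.smul_eq_C_mul, Int.cast_smul_eq_zsmul]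
  exact h

theorem exists_eq_C_mul_map (q : ℚ[X]) :
    ∃ c : ℚ, c ≠ 0 ∧ ∃ g : ℤ[X], q = C c * g.map (Int.castRingHom ℚ) := by
  obtain ⟨b, hb, u, hu⟩ := exists_map_eq_C_mul q
  have hb' : (b : ℚ) ≠ 0 := by exact_mod_cast hb
  refine ⟨(b : ℚ)⁻¹, inv_ne_zero hb', u, ?_⟩
  rw [hu, ← mul_assoc, ← C_mul, inv_mul_cancel₀ hb', C_1, one_mul]

/-- A nonconstant integer polynomial has roots modulo arbitrarily large primes. -/
theorem exists_prime_dvd_eval {g : ℤ[X]} (hg : 0 < g.natDegree) (M : ℕ) :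
    ∃ p : ℕ, p.Prime ∧ M < p ∧ ∃ a : ℤ, (p : ℤ) ∣ g.eval a := by
  obtain hc | hc := eq_or_ne (g.coeff 0) 0
  · obtain ⟨p, hp, hpp⟩ := Nat.exists_infinite_primes (M + 1)
    exact ⟨p, hpp, hp, 0, by simp [← coeff_zero_eq_eval_zero, hc]⟩
  set c := g.coeff 0 with hcdef
  have hM : (M.factorial : ℤ) ≠ 0 := by exact_mod_cast M.factorial_ne_zero
  have hcM : c * M.factorial ≠ 0 := mul_ne_zero hc hM
  have hconst : ∀ e : ℤ, g + C e ≠ 0 := fun e h => by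
    rw [← natDegree_add_C (a := e), h, natDegree_zero] at hg
    exact lt_irrefl _ hg
  -- `t` is chosen so that `g (c * M! * t) ≠ ± c`
  obtain ⟨t, ht⟩ : ∃ t : ℤ,
      (((g + C (-c)) * (g + C c)).comp (C (c * M.factorial) * X)).eval t ≠ 0 := by
    by_contra! h
    have h0 := Polynomial.funext (q := 0) (fun t => by rw [h t, eval_zero])
    rw [comp_eq_zero_iff] at h0
    rcases h0 with h0 | ⟨-, h0⟩
    · exact (mul_ne_zero (hconst _) (hconst _)) h0
    · have := congrArg (fun q => coeff q 1) h0
      simp [hc, M.factorial_ne_zero] at this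
  set a := c * M.factorial * t with ha
  have hga : g.eval a = c * (1 + M.factorial * (t * g.divX.eval a)) := by
    conv_lhs => rw [← divX_mul_X_add g]
    rw [eval_add, eval_mul, eval_X, eval_C, ← hcdef]
    rw [show g.divX.eval a * a = g.divX.eval a * (c * M.factorial * t) by rw [← ha]]
    ring
  set k := 1 + (M.factorial : ℤ) * (t * g.divX.eval a) with hk
  have hk1 : k.natAbs ≠ 1 := by
    intro h
    apply ht
    rw [eval_comp, eval_mul, eval_add, eval_add, eval_C, eval_C, eval_mul, eval_C, eval_X, ← ha,
      hga]
    rcases Int.natAbs_eq k with h' | h' <;> rw [h'] <;> simp [h]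
  obtain ⟨p, hp, hpk⟩ := Nat.exists_prime_and_dvd hk1
  have hpk' : (p : ℤ) ∣ k := Int.natCast_dvd.2 hpk
  refine ⟨p, hp, ?_, a, hga ▸ hpk'.mul_left c⟩
  by_contra! hpM
  have h1 : (p : ℤ) ∣ 1 := by
    rw [hk] at hpk'
    refine (Int.dvd_add_left ?_).1 hpk'
    exact (Int.natCast_dvd_natCast.2 ((Nat.Prime.dvd_factorial hp).2 hpM)).mul_right _
  exact hp.one_lt.ne' (by exact_mod_cast Int.eq_one_of_dvd_one (by positivity) h1)

theorem exists_not_dvd_eval {p : ℕ} (hp : p.Prime) {G : ℤ[X]} (hlc : ¬ (p : ℤ) ∣ G.leadingCoeff)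
    (hdeg : G.natDegree < p) : ∃ a : ℤ, ¬ (p : ℤ) ∣ G.eval a := by
  have : Fact p.Prime := ⟨hp⟩
  have h0 : G.map (Int.castRingHom (ZMod p)) ≠ 0 := fun h => by
    have := congrArg (fun q => coeff q G.natDegree) h
    simp only [coeff_map, coeff_zero, coeff_natDegree, eq_intCast] at this
    exact hlc ((ZMod.intCast_zmod_eq_zero_iff_dvd _ _).1 this)
  obtain ⟨a, ha⟩ := exists_eval_ne_zero_of_natDegree_lt_card _ h0 (by
    rw [Cardinal.mk_fintype, ZMod.card]
    exact_mod_cast natDegree_map_le.trans_lt hdeg)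
  obtain ⟨b, rfl⟩ := ZMod.intCast_surjective a
  refine ⟨b, fun h => ha ?_⟩
  rw [eval_intCast_map, eq_intCast]
  exact (ZMod.intCast_zmod_eq_zero_iff_dvd _ _).2 h

/-- The Bezout identity over `ℚ` after clearing denominators: a polynomial that is irreducible over
`ℚ` and `Q` have no common root modulo `p`, for all but finitely many `p`, unless the first divides
`Q` over `ℚ`. -/
theorem exists_bezout_eq_C {g Q : ℤ[X]} (hg : Irreducible (g.map (Int.castRingHom ℚ)))
    (hgQ : ¬ g.map (Int.castRingHom ℚ) ∣ Q.map (Int.castRingHom ℚ)) :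
    ∃ n : ℤ, n ≠ 0 ∧ ∃ u v : ℤ[X], u * g + v * Q = C n := by
  obtain ⟨u, v, huv⟩ := (hg.coprime_iff_not_dvd).2 hgQ
  obtain ⟨b, hb, u', hu⟩ := exists_map_eq_C_mul u
  obtain ⟨c, hc, v', hv⟩ := exists_map_eq_C_mul v
  refine ⟨b * c, mul_ne_zero hb hc, C c * u', C b * v', ?_⟩
  apply map_injective (Int.castRingHom ℚ) Int.cast_injective
  simp only [Polynomial.map_add, Polynomial.map_mul, map_C, hu, hv, C_mul,
    Int.coe_castRingHom]
  linear_combination (C (b : ℚ) * C (c : ℚ)) * huv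

/-- Eisenstein's criterion for a binomial, over `ℚ`. -/
theorem irreducible_binomial {P c : ℤ} {k q : ℕ} (hq : q.Prime) (hk : 0 < k)
    (hPc : IsCoprime P c) (hqP : ¬ (q : ℤ) ∣ P) (hqc : (q : ℤ) ∣ c) (hqc2 : ¬ (q : ℤ) ^ 2 ∣ c) :
    Irreducible ((C P * X ^ k + C c : ℤ[X]).map (Int.castRingHom ℚ)) := by
  have hP : P ≠ 0 := fun h => hqP (h ▸ dvd_zero _)
  have hnd : (C P * X ^ k + C c : ℤ[X]).natDegree = k := by
    rw [natDegree_add_C, natDegree_C_mul_X_pow _ _ hP]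
  have hcoeff : ∀ n, (C P * X ^ k + C c : ℤ[X]).coeff n =
      (if n = k then P else 0) + if n = 0 then c else 0 := fun n => by
    rw [coeff_add, coeff_C_mul_X_pow, coeff_C]
  have hcoeffk : (C P * X ^ k + C c : ℤ[X]).coeff k = P := by
    rw [hcoeff, if_pos rfl, if_neg hk.ne', add_zero]
  have hcoeff0 : (C P * X ^ k + C c : ℤ[X]).coeff 0 = c := by
    rw [hcoeff, if_pos rfl, if_neg hk.ne, zero_add]
  have hprim : (C P * X ^ k + C c : ℤ[X]).IsPrimitive := by
    intro r hr
    rw [C_dvd_iff_dvd_coeff] at hr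
    exact hPc.isUnit_of_dvd' (hcoeffk ▸ hr k) (hcoeff0 ▸ hr 0)
  rw [← IsPrimitive.Int.irreducible_iff_irreducible_map_cast hprim]
  have hdeg : (C P * X ^ k + C c : ℤ[X]).degree = k := by
    rw [degree_eq_natDegree hprim.ne_zero, hnd]
  refine irreducible_of_eisenstein_criterion (P := Ideal.span {(q : ℤ)}) ?_ ?_ ?_ ?_ ?_ hprim
  · rw [Ideal.span_singleton_prime (by exact_mod_cast hq.ne_zero)]
    exact Nat.prime_iff_prime_int.1 hq
  · rwa [leadingCoeff, hnd, hcoeffk, Ideal.mem_span_singleton]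
  · intro n hn
    rw [hdeg, Nat.cast_lt] at hn
    rw [hcoeff, if_neg hn.ne, zero_add, Ideal.mem_span_singleton]
    split_ifs
    exacts [hqc, dvd_zero _]
  · rw [hdeg]; exact_mod_cast hk
  · rwa [hcoeff0, Ideal.span_singleton_pow, Ideal.mem_span_singleton]

/-! ### Binomials for the prime progressions -/

/-- If the elements of `l` miss a residue class modulo every prime, then some translate of `l`
avoids all multiples of the primes `p ≤ K`, while each of its elements is divisible exactly once by
some larger prime. -/
theorem exists_shift (K : ℕ) (l : List ℕ)
    (hl : ∀ p : ℕ, p.Prime → ∃ r : ZMod p, ∀ e ∈ l, (e : ZMod p) ≠ r) :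
    ∃ c : ℕ, (∀ p : ℕ, p.Prime → p ≤ K → ∀ e ∈ l, ¬ p ∣ c + e) ∧
      ∀ e ∈ l, ∃ q : ℕ, q.Prime ∧ K < q ∧ q ∣ c + e ∧ ¬ q ^ 2 ∣ c + e := by
  choose r hr using hl
  have hprime := Nat.prime_nth_prime
  -- The `i`-th prime takes care of the first condition if `i < K`, and of the element `i - K`
  -- of `l` otherwise.
  obtain ⟨c, hc⟩ := Nat.chineseRemainderOfFinset
    (fun i => if i < K then (-(r _ (hprime i))).val else Nat.nth Nat.Prime i - (i - K))
    (fun i => Nat.nth Nat.Prime i ^ 2) (Finset.range (K + l.sum + 1))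
    (fun i _ => pow_ne_zero 2 (hprime i).ne_zero)
    (fun i _ j _ hij => Nat.Coprime.pow 2 2 ((Nat.coprime_primes (hprime i) (hprime j)).2
      fun h => hij (Nat.nth_injective Nat.infinite_setOfPred_prime h)))
  refine ⟨c, fun p hp hpK e he hdvd => ?_, fun e he => ?_⟩
  · obtain ⟨i, rfl⟩ : ∃ i, Nat.nth Nat.Prime i = p := ⟨_, Nat.nth_count hp⟩
    have hi := Nat.add_two_le_nth_prime i
    have h := hc i (Finset.mem_range.2 (by omega))
    have : NeZero (Nat.nth Nat.Prime i) := ⟨hp.ne_zero⟩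
    simp only [if_pos (show i < K by omega)] at h
    have h' := (ZMod.natCast_eq_natCast_iff _ _ _).2 (h.of_dvd (dvd_pow_self _ two_ne_zero))
    rw [ZMod.natCast_zmod_val] at h'
    have h0 := (ZMod.natCast_eq_zero_iff _ _).2 hdvd
    rw [Nat.cast_add, h'] at h0
    exact hr _ hp e he (by linear_combination h0)
  · have hi := Nat.add_two_le_nth_prime (K + e)
    have hel : e ≤ l.sum := List.le_sum_of_mem he
    have h := hc (K + e) (Finset.mem_range.2 (by omega))
    simp only [if_neg (show ¬ K + e < K by omega), Nat.add_sub_cancel_left] at h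
    set q := Nat.nth Nat.Prime (K + e)
    have hq : q.Prime := hprime (K + e)
    have h' : c + e ≡ q [MOD q ^ 2] := by
      have := h.add_right e
      rwa [Nat.sub_add_cancel (by omega)] at this
    refine ⟨q, hq, by omega, ?_, fun h2 => ?_⟩
    · exact ((h'.of_dvd (dvd_pow_self _ two_ne_zero)).dvd_iff dvd_rfl).2 dvd_rfl
    · have := Nat.le_of_dvd hq.pos ((h'.dvd_iff dvd_rfl).1 h2)
      nlinarith [hq.two_le]

/-! ### The recursive choice of residues -/

/-- A stage of the construction of `τ`: the residues of `τ` modulo the primes `p ≤ bound` are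
fixed, and `poly` is the product of the polynomials treated so far. The values of `residue` at
larger numbers are irrelevant. -/
structure Stage where
  /-- The primes up to this bound have been treated. -/
  bound : ℕ
  /-- A representative of the residue of `τ_p` modulo `p`. -/
  residue : ℕ → ℤ
  /-- The product of the polynomials treated so far. -/
  poly : ℤ[X]

/-- A stage from which the construction can go on: no residue class modulo a prime beyond the bound
is forced to be a root of `poly`. -/
structure Stage.Valid (s : Stage) : Prop where
  ne_zero : s.poly ≠ 0
  exists_not_dvd : ∀ p : ℕ, p.Prime → s.bound < p → ∃ a : ℤ, ¬ (p : ℤ) ∣ s.poly.eval a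

/-- The stage `s'` refines the stage `s`: the polynomials treated at `s` become units at the primes
that are treated at `s'` but not at `s`. -/
structure Stage.Extends (s s' : Stage) : Prop where
  bound_lt : s.bound < s'.bound
  residue_eq : ∀ p ≤ s.bound, s'.residue p = s.residue p
  dvd : s.poly ∣ s'.poly
  not_dvd : ∀ p : ℕ, p.Prime → s.bound < p → p ≤ s'.bound →
    ¬ (p : ℤ) ∣ s.poly.eval (s'.residue p)

/-- The step from `s` to `s'` treats the polynomial `g`: some new prime `p` divides the value of
`g`, but neither the leading coefficient of `g` nor that of `s.poly`. If `s'` extends `s`, then `p`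
does not divide the value of `s.poly` either. In `R_τ` this forces the `p`-adic norms of the leading
coefficients of the primes associated with `g` and with the factors of `s.poly` to be different. -/
structure IsSeparatingStep (s s' : Stage) (g : ℤ[X]) : Prop where
  irreducible : Irreducible (g.map (Int.castRingHom ℚ))
  poly_eq : s'.poly = s.poly * g
  exists_prime : ∃ p : ℕ, p.Prime ∧ s.bound < p ∧ p ≤ s'.bound ∧ ¬ (p : ℤ) ∣ g.leadingCoeff ∧
    ¬ (p : ℤ) ∣ s.poly.leadingCoeff ∧ (p : ℤ) ∣ g.eval (s'.residue p)

/-- The step from `s` to `s'` treats a progression with differences `d` and initial term `F`, of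
degree at least `n`. -/
structure IsProgressionStep (s s' : Stage) (d : List ℕ) (n : ℕ) (F : ℤ[X]) : Prop where
  irreducible : ∀ e ∈ 0 :: d, Irreducible ((F + C (e : ℤ)).map (Int.castRingHom ℚ))
  poly_eq : s'.poly = s.poly * ∏ e ∈ (0 :: d).toFinset, (F + C (e : ℤ))
  natDegree_lt : s.poly.natDegree < F.natDegree
  le_natDegree : n ≤ F.natDegree
  leadingCoeff_pos : 0 < F.leadingCoeff
  not_dvd : ∀ e ∈ 0 :: d, ∀ p : ℕ, p.Prime → p ≤ s'.bound → ∀ a : ℤ,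
    ¬ (p : ℤ) ∣ (F + C (e : ℤ)).eval a

theorem Stage.valid_of_le {s : Stage} (h0 : s.poly ≠ 0)
    (hlc : s.poly.leadingCoeff.natAbs ≤ s.bound) (hdeg : s.poly.natDegree ≤ s.bound) :
    s.Valid :=
  ⟨h0, fun _ hp hlt => exists_not_dvd_eval hp (fun h =>
    (Nat.le_of_dvd (Int.natAbs_pos.2 (leadingCoeff_ne_zero.2 h0)) (Int.natCast_dvd.1 h)).not_gt
      (hlc.trans_lt hlt)) (hdeg.trans_lt hlt)⟩

theorem Stage.Valid.exists_residue {s : Stage} (hs : s.Valid) :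
    ∃ r : ℕ → ℤ, (∀ p ≤ s.bound, r p = s.residue p) ∧
      ∀ p : ℕ, p.Prime → s.bound < p → ¬ (p : ℤ) ∣ s.poly.eval (r p) := by
  classical
  choose a ha using hs.exists_not_dvd
  refine ⟨fun p => if h : p.Prime ∧ s.bound < p then a p h.1 h.2 else s.residue p,
    fun p hp => dif_neg fun h => h.2.not_ge hp, fun p hp hlt => ?_⟩
  simpa only [dif_pos (And.intro hp hlt)] using ha p hp hlt

theorem Stage.Valid.exists_extends_poly_eq {s : Stage} (hs : s.Valid) :
    ∃ s' : Stage, s'.Valid ∧ s.Extends s' ∧ s'.poly = s.poly := by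
  obtain ⟨r, hr, hr'⟩ := hs.exists_residue
  exact ⟨⟨s.bound + 1, r, s.poly⟩,
    ⟨hs.ne_zero, fun p hp h => hs.exists_not_dvd p hp (lt_of_le_of_lt (Nat.le_succ _) h)⟩,
    ⟨Nat.lt_succ_self _, hr, dvd_rfl, fun p hp h _ => hr' p hp h⟩, rfl⟩

theorem Stage.Valid.exists_isSeparatingStep {s : Stage} (hs : s.Valid) {g : ℤ[X]}
    (hg : Irreducible (g.map (Int.castRingHom ℚ)))
    (hgQ : ¬ g.map (Int.castRingHom ℚ) ∣ s.poly.map (Int.castRingHom ℚ)) :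
    ∃ s' : Stage, s'.Valid ∧ s.Extends s' ∧ IsSeparatingStep s s' g := by
  obtain ⟨r, hr, hr'⟩ := hs.exists_residue
  obtain ⟨n, hn, u, v, huv⟩ := exists_bezout_eq_C hg hgQ
  have hg0 : g ≠ 0 := fun h => hg.ne_zero (by rw [h, Polynomial.map_zero])
  have hdeg : 0 < g.natDegree :=
    (natDegree_map_eq_of_injective Int.cast_injective g : (g.map (Int.castRingHom ℚ)).natDegree = _)
      ▸ hg.natDegree_pos
  obtain ⟨p, hp, hlt, a, ha⟩ := exists_prime_dvd_eval hdeg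
    (s.bound + n.natAbs + g.leadingCoeff.natAbs + s.poly.leadingCoeff.natAbs)
  have key : ∀ m : ℤ, m ≠ 0 → m.natAbs < p → ¬ (p : ℤ) ∣ m := fun m hm hlt h =>
    (Nat.le_of_dvd (Int.natAbs_pos.2 hm) (Int.natCast_dvd.1 h)).not_gt hlt
  have haQ : ¬ (p : ℤ) ∣ s.poly.eval a := fun h => key n hn (by omega) (by
    have := congrArg (eval a) huv
    rw [eval_add, eval_mul, eval_mul, eval_C] at this
    rw [← this]
    exact dvd_add (ha.mul_left _) (h.mul_left _))
  have hne : s.poly * g ≠ 0 := mul_ne_zero hs.ne_zero hg0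
  refine ⟨⟨p + (s.poly * g).leadingCoeff.natAbs + (s.poly * g).natDegree,
    Function.update r p a, s.poly * g⟩, Stage.valid_of_le hne (by dsimp only; omega)
      (by dsimp only; omega), ⟨?_, ?_, Dvd.intro _ rfl, ?_⟩, ⟨hg, rfl, p, hp, ?_, ?_, ?_, ?_, ?_⟩⟩
  · dsimp only; omega
  · intro q hq
    dsimp only
    rw [Function.update_of_ne (by omega), hr q hq]
  · intro q hq hlt' _
    dsimp only
    obtain rfl | hqp := eq_or_ne q p
    · rwa [Function.update_self]
    · rw [Function.update_of_ne hqp]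
      exact hr' q hq hlt'
  · omega
  · dsimp only; omega
  · exact key _ (leadingCoeff_ne_zero.2 hg0) (by omega)
  · exact key _ (leadingCoeff_ne_zero.2 hs.ne_zero) (by omega)
  · dsimp only
    rwa [Function.update_self]

theorem Stage.Valid.exists_isProgressionStep {s : Stage} (hs : s.Valid) {d : List ℕ}
    (hd : d ∈ AdmissibleSeq) (n : ℕ) :
    ∃ s' : Stage, s'.Valid ∧ s.Extends s' ∧ ∃ F, IsProgressionStep s s' d n F := by
  classical
  obtain ⟨r, hr, hr'⟩ := hs.exists_residue
  set k := s.poly.natDegree + n + 1 with hk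
  set K := s.bound + s.poly.leadingCoeff.natAbs + s.poly.natDegree +
    (0 :: d).toFinset.card * k + 1 with hK
  obtain ⟨c, hc, hc'⟩ := exists_shift K (0 :: d) hd.2.2.2
  -- Modulo each prime `p ≤ K` the polynomial `F` is the constant `c`.
  set F : ℤ[X] := C (K.factorial : ℤ) * X ^ k + C (c : ℤ) with hF
  have hK0 : (K.factorial : ℤ) ≠ 0 := by exact_mod_cast K.factorial_ne_zero
  have hFe : ∀ e : ℕ, F + C (e : ℤ) = C (K.factorial : ℤ) * X ^ k + C ((c + e : ℕ) : ℤ) :=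
    fun e => by rw [hF, add_assoc, ← C_add, Nat.cast_add]
  have hnd : ∀ e : ℤ, (F + C e).natDegree = k := fun e => by
    rw [natDegree_add_C, hF, natDegree_add_C, natDegree_C_mul_X_pow _ _ hK0]
  have hnd0 : F.natDegree = k := by rw [hF, natDegree_add_C, natDegree_C_mul_X_pow _ _ hK0]
  have hlc : ∀ e : ℕ, (F + C (e : ℤ)).leadingCoeff = K.factorial := fun e => by
    rw [leadingCoeff, hnd, hFe, coeff_add, coeff_C_mul_X_pow, if_pos rfl, coeff_C,
      if_neg (by omega), add_zero]
  have hFlc : F.leadingCoeff = K.factorial := by simpa using hlc 0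
  have hne : ∀ e : ℕ, F + C (e : ℤ) ≠ 0 := fun e h => hK0 (by rw [← hlc e, h, leadingCoeff_zero])
  have hprod : ∏ e ∈ (0 :: d).toFinset, (F + C (e : ℤ)) ≠ 0 :=
    Finset.prod_ne_zero_iff.2 fun e _ => hne e
  refine ⟨⟨K, r, s.poly * ∏ e ∈ (0 :: d).toFinset, (F + C (e : ℤ))⟩,
    ⟨mul_ne_zero hs.ne_zero hprod, fun p hp hlt => ?_⟩,
    ⟨by dsimp only; omega, hr, Dvd.intro _ rfl, fun p hp h _ => hr' p hp h⟩, F,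
    ⟨fun e he => ?_, rfl, by omega, by omega, ?_, fun e he p hp hpK a h => ?_⟩⟩
  · dsimp only at hlt ⊢
    have hpZ := Nat.prime_iff_prime_int.1 hp
    refine exists_not_dvd_eval hp ?_ ?_
    · rw [leadingCoeff_mul, leadingCoeff_prod, Finset.prod_congr rfl fun e _ => hlc e,
        Finset.prod_const]
      intro h
      rcases hpZ.dvd_or_dvd h with h | h
      · have := Nat.le_of_dvd (Int.natAbs_pos.2 (leadingCoeff_ne_zero.2 hs.ne_zero))
          (Int.natCast_dvd.1 h)
        omega
      · exact hlt.not_ge ((Nat.Prime.dvd_factorial hp).1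
          (Int.natCast_dvd_natCast.1 (hpZ.dvd_of_dvd_pow h)))
    · rw [natDegree_mul hs.ne_zero hprod, natDegree_prod _ _ fun e _ => hne e,
        Finset.sum_congr rfl fun (e : ℕ) _ => hnd e, Finset.sum_const, smul_eq_mul]
      omega
  · obtain ⟨q, hq, hKq, hqc, hqc2⟩ := hc' e he
    rw [hFe]
    refine irreducible_binomial hq (by omega) ?_ ?_ ?_ ?_
    · rw [Nat.isCoprime_iff_coprime]
      refine Nat.Coprime.symm (Nat.coprime_of_dvd fun p hp h1 h2 => ?_)
      exact hc p hp ((Nat.Prime.dvd_factorial hp).1 h2) e he h1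
    · rw [Int.natCast_dvd_natCast, Nat.Prime.dvd_factorial hq]
      exact hKq.not_ge
    · exact_mod_cast hqc
    · exact_mod_cast hqc2
  · rw [hFlc]
    exact_mod_cast K.factorial_pos
  · dsimp only at hpK
    rw [hFe, eval_add, eval_mul, eval_C, eval_C] at h
    refine hc p hp hpK e he (Int.natCast_dvd_natCast.1 ((Int.dvd_add_right ?_).1 h))
    exact (Int.natCast_dvd_natCast.2 ((Nat.Prime.dvd_factorial hp).2 hpK)).mul_right _

/-- What has to be done in the step from `s` to `s'`: either treat an integer polynomial, or treat a
progression with given differences and of given minimal degree. -/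
def StepSpec (D : Set (List ℕ)) (s s' : Stage) : ℤ[X] ⊕ (List ℕ × ℕ) → Prop
  | .inl g => (s'.poly = s.poly ∧ (Irreducible (g.map (Int.castRingHom ℚ)) →
      g.map (Int.castRingHom ℚ) ∣ s.poly.map (Int.castRingHom ℚ))) ∨ IsSeparatingStep s s' g
  | .inr (d, n) => (s'.poly = s.poly ∧ d ∉ D) ∨ (d ∈ D ∧ ∃ F, IsProgressionStep s s' d n F)

theorem Stage.Valid.exists_stepSpec {D : Set (List ℕ)} (hD : D ⊆ AdmissibleSeq) {s : Stage}
    (hs : s.Valid) (t : ℤ[X] ⊕ (List ℕ × ℕ)) :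
    ∃ s' : Stage, s'.Valid ∧ s.Extends s' ∧ StepSpec D s s' t := by
  obtain ⟨s', hs', hss', heq⟩ := hs.exists_extends_poly_eq
  rcases t with g | ⟨d, n⟩
  · by_cases hg : Irreducible (g.map (Int.castRingHom ℚ)) →
      g.map (Int.castRingHom ℚ) ∣ s.poly.map (Int.castRingHom ℚ)
    · exact ⟨s', hs', hss', .inl ⟨heq, hg⟩⟩
    · push Not at hg
      obtain ⟨s'', h, h', h''⟩ := hs.exists_isSeparatingStep hg.1 hg.2
      exact ⟨s'', h, h', .inr h''⟩
  · by_cases hd : d ∈ D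
    · obtain ⟨s'', h, h', h''⟩ := hs.exists_isProgressionStep (hD hd) n
      exact ⟨s'', h, h', .inr ⟨hd, h''⟩⟩
    · exact ⟨s', hs', hss', .inl ⟨heq, hd⟩⟩

/-- The whole sequence of stages. Each polynomial and each progression is treated at exactly one
stage. -/
structure Tower (D : Set (List ℕ)) where
  /-- The sequence of stages. -/
  stage : ℕ → Stage
  /-- The enumeration of what has to be treated. -/
  task : ℕ ≃ ℤ[X] ⊕ (List ℕ × ℕ)
  /-- The initial terms of the progressions. -/
  start : List ℕ → ℕ → ℤ[X]
  poly_zero : (stage 0).poly = 1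
  poly_ne_zero : ∀ N, (stage N).poly ≠ 0
  stage_extends : ∀ N, (stage N).Extends (stage (N + 1))
  stepSpec : ∀ N, StepSpec D (stage N) (stage (N + 1)) (task N)
  isProgressionStep : ∀ d ∈ D, ∀ n N, task N = .inr (d, n) →
    IsProgressionStep (stage N) (stage (N + 1)) d n (start d n)

theorem nonempty_tower {D : Set (List ℕ)} (hD : D ⊆ AdmissibleSeq) : Nonempty (Tower D) := by
  have : Countable ℤ[X] :=
    Cardinal.mk_le_aleph0_iff.1 (Polynomial.cardinalMk_le_max.trans (by simp))
  obtain ⟨t⟩ : Nonempty (ℕ ≃ ℤ[X] ⊕ (List ℕ × ℕ)) := nonempty_equiv_of_countable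
  choose next hvalid hext hspec using
    fun (s : {s : Stage // s.Valid}) t => s.2.exists_stepSpec hD t
  let s₀ : {s : Stage // s.Valid} := ⟨⟨1, 0, 1⟩, Stage.valid_of_le one_ne_zero (by simp) (by simp)⟩
  let S : ℕ → {s : Stage // s.Valid} :=
    fun N => Nat.rec s₀ (fun N s => ⟨next s (t N), hvalid s (t N)⟩) N
  have hS : ∀ N, StepSpec D (S N).1 (S (N + 1)).1 (t N) := fun N => hspec _ _
  have hF : ∀ d n, ∃ F, d ∈ D → ∀ N, t N = .inr (d, n) →
      IsProgressionStep (S N).1 (S (N + 1)).1 d n F := fun d n => by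
    by_cases hd : d ∈ D
    · have h := hS (t.symm (.inr (d, n)))
      rw [t.apply_symm_apply] at h
      rcases h with h | ⟨-, F, hF⟩
      · exact absurd hd h.2
      · refine ⟨F, fun _ N hN => ?_⟩
        obtain rfl : N = t.symm (.inr (d, n)) := by rw [← hN, t.symm_apply_apply]
        exact hF
    · exact ⟨0, fun h => absurd h hd⟩
  choose F hF using hF
  exact ⟨⟨fun N => (S N).1, t, F, rfl, fun N => (S N).2.ne_zero, fun N => hext _ _, hS,
    fun d hd n => hF d n hd⟩⟩

section

variable {S : ℕ → Stage} (hS : ∀ N, (S N).Extends (S (N + 1)))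
include hS

theorem le_bound (N : ℕ) : N ≤ (S N).bound :=
  (strictMono_nat_of_lt_succ fun N => (hS N).bound_lt).id_le N

theorem bound_mono : Monotone fun N => (S N).bound :=
  (strictMono_nat_of_lt_succ fun N => (hS N).bound_lt).monotone

theorem poly_dvd {M N : ℕ} (h : M ≤ N) : (S M).poly ∣ (S N).poly :=
  Nat.le_induction dvd_rfl (fun N _ ih => ih.trans (hS N).dvd) N h

theorem residue_eq {M N p : ℕ} (h : M ≤ N) (hp : p ≤ (S M).bound) :
    (S N).residue p = (S M).residue p :=
  Nat.le_induction rfl (fun N hN ih =>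
    ((hS N).residue_eq p (hp.trans (bound_mono hS hN))).trans ih) N h

/-- The residues of the limit may be read off at any stage at which they are fixed. -/
theorem residue_self_eq {N p : ℕ} (hp : p ≤ (S N).bound) :
    (S p).residue p = (S N).residue p := by
  rw [← residue_eq hS (le_max_left p N) (le_bound hS p), residue_eq hS (le_max_right p N) hp]

theorem not_dvd_eval_residue {N p : ℕ} (hp : p.Prime) (h : (S N).bound < p) :
    ¬ (p : ℤ) ∣ (S N).poly.eval ((S p).residue p) := by
  obtain ⟨M, hM⟩ : ∃ M, p ≤ (S M).bound := ⟨p, le_bound hS p⟩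
  induction M with
  | zero => exact absurd (hM.trans (bound_mono hS N.zero_le)) h.not_ge
  | succ M ih =>
    by_cases hpM : p ≤ (S M).bound
    · exact ih hpM
    · push Not at hpM
      have hNM : N ≤ M := by
        by_contra! hMN
        exact (hM.trans (bound_mono hS hMN)).not_gt h
      rw [residue_self_eq hS hM]
      exact fun hdvd => (hS M).not_dvd p hp hpM hM
        (hdvd.trans (eval_dvd (poly_dvd hS hNM)))

end

/-! ### Values of rational polynomials at a profinite integer -/

/-- The `p`-adic norm of the value `q(τ_p)`. -/
noncomputable def valueNorm (τ : ProfiniteInt) (p : Nat.Primes) (q : ℚ[X]) : ℝ :=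
  ‖aeval (R := ℚ) ((τ p : ℤ_[(p : ℕ)]) : ℚ_[(p : ℕ)]) q‖

theorem mem_ringR_iff {τ : ProfiniteInt} {q : ℚ[X]} :
    q ∈ ringR τ ↔ ∀ p, valueNorm τ p q ≤ 1 := mem_ringR τ q

section

variable (τ : ProfiniteInt) (p : Nat.Primes)

theorem valueNorm_nonneg (q : ℚ[X]) : 0 ≤ valueNorm τ p q := norm_nonneg _

theorem valueNorm_mul (q r : ℚ[X]) :
    valueNorm τ p (q * r) = valueNorm τ p q * valueNorm τ p r := by
  simp only [valueNorm, map_mul, norm_mul]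

theorem valueNorm_C (c : ℚ) : valueNorm τ p (C c) = ‖(c : ℚ_[(p : ℕ)])‖ := by
  simp only [valueNorm, aeval_C, eq_ratCast]

theorem aeval_map_intCast (g : ℤ[X]) :
    aeval (R := ℚ) ((τ p : ℤ_[(p : ℕ)]) : ℚ_[(p : ℕ)]) (g.map (Int.castRingHom ℚ)) =
      ((aeval (τ p) g : ℤ_[(p : ℕ)]) : ℚ_[(p : ℕ)]) := by
  rw [← algebraMap_int_eq, aeval_map_algebraMap]
  exact aeval_algebraMap_apply ℚ_[(p : ℕ)] (τ p) g

theorem valueNorm_map (g : ℤ[X]) :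
    valueNorm τ p (g.map (Int.castRingHom ℚ)) = ‖aeval (τ p) g‖ := by
  rw [valueNorm, aeval_map_intCast, PadicInt.norm_def]

theorem valueNorm_map_le_one (g : ℤ[X]) : valueNorm τ p (g.map (Int.castRingHom ℚ)) ≤ 1 := by
  rw [valueNorm_map]
  exact PadicInt.norm_le_one _

/-- Whether the value of an integer polynomial is a `p`-adic unit depends on a residue only. -/
theorem valueNorm_map_lt_one_iff {r : ℤ} (hr : ‖τ p - r‖ < 1) (g : ℤ[X]) :
    valueNorm τ p (g.map (Int.castRingHom ℚ)) < 1 ↔ ((p : ℕ) : ℤ) ∣ g.eval r := by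
  rw [valueNorm_map, ← PadicInt.norm_int_lt_one_iff_dvd, PadicInt.norm_lt_one_iff_dvd,
    PadicInt.norm_lt_one_iff_dvd]
  rw [PadicInt.norm_lt_one_iff_dvd] at hr
  refine dvd_iff_dvd_of_dvd_sub (hr.trans ?_)
  have := sub_dvd_eval_sub (τ p) (r : ℤ_[(p : ℕ)]) (g.map (Int.castRingHom ℤ_[(p : ℕ)]))
  rwa [eval_intCast_map, eval_map, eq_intCast] at this

end

theorem map_mem_ringR (τ : ProfiniteInt) (g : ℤ[X]) : g.map (Int.castRingHom ℚ) ∈ ringR τ :=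
  mem_ringR_iff.2 fun p => valueNorm_map_le_one τ p g

theorem exists_int_eq_of_norm_le_one {c : ℚ}
    (hc : ∀ p : Nat.Primes, ‖(c : ℚ_[(p : ℕ)])‖ ≤ 1) : ∃ z : ℤ, c = z := by
  refine ⟨c.num, (Rat.den_eq_one_iff c).1 ?_ |>.symm⟩
  by_contra hden
  obtain ⟨p, hp, hpd⟩ := Nat.exists_prime_and_dvd hden
  have : Fact p.Prime := ⟨hp⟩
  have h1 : ‖((c.den : ℤ) : ℚ_[p])‖ < 1 :=
    Padic.norm_intCast_lt_one_iff.2 (Int.natCast_dvd_natCast.2 hpd)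
  have h2 : ‖(c.num : ℚ_[p])‖ < 1 := by
    have h : (c.num : ℚ_[p]) = (c : ℚ_[p]) * ((c.den : ℤ) : ℚ_[p]) := by
      have := Rat.mul_den_eq_num c
      exact_mod_cast this.symm
    rw [h, norm_mul]
    exact mul_lt_one_of_nonneg_of_lt_one_right (hc ⟨p, hp⟩) (norm_nonneg _) h1
  have h3 := Padic.norm_intCast_lt_one_iff.1 h2
  exact Nat.not_coprime_of_dvd_of_dvd hp.one_lt (Int.natCast_dvd.1 h3) hpd c.reduced

theorem eq_one_or_eq_neg_one_of_norm_eq_one {c : ℚ}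
    (hc : ∀ p : Nat.Primes, ‖(c : ℚ_[(p : ℕ)])‖ = 1) : c = 1 ∨ c = -1 := by
  obtain ⟨z, rfl⟩ := exists_int_eq_of_norm_le_one fun p => (hc p).le
  obtain ⟨w, hw⟩ := exists_int_eq_of_norm_le_one (c := (z : ℚ)⁻¹) fun p => by
    rw [Rat.cast_inv, norm_inv, hc p, inv_one]
  have hz : (z : ℚ) ≠ 0 := fun h => by
    have := hc ⟨2, Nat.prime_two⟩
    simp [h] at this
  have hzw : z * w = 1 := by
    have : (z : ℚ) * w = 1 := by rw [← hw, mul_inv_cancel₀ hz]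
    exact_mod_cast this
  rcases Int.eq_one_or_neg_one_of_mul_eq_one hzw with h | h <;> simp [h]

theorem norm_natCast_prime_of_ne {p q : Nat.Primes} (h : q ≠ p) :
    ‖((p : ℕ) : ℚ_[(q : ℕ)])‖ = 1 :=
  Padic.norm_natCast_eq_one_iff.2 ((Nat.coprime_primes q.2 p.2).2 fun h' => h (Subtype.ext h'))

/-- All values of nonzero polynomials at `τ` are nonzero, and units at almost all primes. This is
the condition that makes `R_τ` a principal ideal domain. -/
structure IsAlmostUnit (τ : ProfiniteInt) : Prop where
  ne_zero : ∀ p, ∀ q : ℚ[X], q ≠ 0 → valueNorm τ p q ≠ 0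
  finite : ∀ q : ℚ[X], q ≠ 0 → {p | valueNorm τ p q ≠ 1}.Finite

/-- Every nonzero polynomial has a rational multiple whose value at `τ` is a unit of the profinite
integers. -/
theorem IsAlmostUnit.exists_normalized {τ : ProfiniteInt} (hτ : IsAlmostUnit τ) {q : ℚ[X]}
    (hq : q ≠ 0) : ∃ c : ℚ, c ≠ 0 ∧ ∀ p, valueNorm τ p (C c * q) = 1 := by
  classical
  suffices H : ∀ (s : Finset Nat.Primes) (q : ℚ[X]), q ≠ 0 → (∀ p ∉ s, valueNorm τ p q = 1) →
      ∃ c : ℚ, c ≠ 0 ∧ ∀ p, valueNorm τ p (C c * q) = 1 by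
    refine H (hτ.finite q hq).toFinset q hq fun p hp => ?_
    by_contra h
    exact hp ((hτ.finite q hq).mem_toFinset.2 h)
  intro s
  induction s using Finset.induction_on with
  | empty => exact fun q _ h => ⟨1, one_ne_zero, fun p => by
      rw [C_1, one_mul]; exact h p (Finset.notMem_empty p)⟩
  | insert a s ha ih =>
    intro q hq h
    have hne : aeval (R := ℚ) ((τ a : ℤ_[(a : ℕ)]) : ℚ_[(a : ℕ)]) q ≠ 0 :=
      norm_ne_zero_iff.1 (hτ.ne_zero a q hq)
    have ha0 : ((a : ℕ) : ℚ) ≠ 0 := by exact_mod_cast a.2.ne_zero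
    set m := (aeval (R := ℚ) ((τ a : ℤ_[(a : ℕ)]) : ℚ_[(a : ℕ)]) q).valuation
    have hc0 : ((a : ℕ) : ℚ) ^ (-m) ≠ 0 := zpow_ne_zero _ ha0
    obtain ⟨c, hc, hc'⟩ := ih (C (((a : ℕ) : ℚ) ^ (-m)) * q) (mul_ne_zero (C_ne_zero.2 hc0) hq)
      fun p hp => by
        rw [valueNorm_mul, valueNorm_C, Rat.cast_zpow, Rat.cast_natCast]
        obtain rfl | hpa := eq_or_ne p a
        · rw [Padic.norm_p_zpow, neg_neg, valueNorm, Padic.norm_eq_zpow_neg_valuation hne,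
            ← zpow_add₀ (by exact_mod_cast p.2.ne_zero), add_neg_cancel, zpow_zero]
        · rw [norm_zpow, norm_natCast_prime_of_ne hpa, one_zpow, one_mul]
          exact h p fun hp' => (Finset.mem_insert.1 hp').elim hpa hp
    exact ⟨c * ((a : ℕ) : ℚ) ^ (-m), mul_ne_zero hc hc0, fun p => by
      rw [C_mul, mul_assoc]; exact hc' p⟩

/-! ### Primes of `R_τ` -/

section

variable {τ : ProfiniteInt}

theorem natDegree_eq_zero_of_isUnit {f : ringR τ} (hf : IsUnit f) :
    (f : ℚ[X]).natDegree = 0 :=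
  Polynomial.natDegree_eq_zero_of_isUnit (hf.map (ringR τ).subtype)

theorem exists_eq_natCast_mul {p : Nat.Primes} {f : ringR τ} (hf : valueNorm τ p f < 1) :
    ∃ g : ringR τ, f = ((p : ℕ) : ringR τ) * g := by
  have hp0 : ((p : ℕ) : ℚ) ≠ 0 := by exact_mod_cast p.2.ne_zero
  have hmem : C (((p : ℕ) : ℚ)⁻¹) * (f : ℚ[X]) ∈ ringR τ := by
    rw [mem_ringR_iff]
    intro q
    rw [valueNorm_mul, valueNorm_C, Rat.cast_inv, Rat.cast_natCast, norm_inv]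
    obtain rfl | hqp := eq_or_ne q p
    · set x : ℤ_[(q : ℕ)] := ⟨_, (mem_ringR τ f).1 f.2 q⟩ with hx
      have hxf : valueNorm τ q f = ‖x‖ := rfl
      rw [hxf] at hf ⊢
      obtain ⟨w, hw⟩ := (PadicInt.norm_lt_one_iff_dvd x).1 hf
      rw [hw, norm_mul, PadicInt.norm_p, Padic.norm_p, inv_inv, ← mul_assoc,
        mul_inv_cancel₀ (by exact_mod_cast q.2.ne_zero), one_mul]
      exact PadicInt.norm_le_one w
    · rw [norm_natCast_prime_of_ne hqp, inv_one, one_mul]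
      exact mem_ringR_iff.1 f.2 q
  refine ⟨⟨_, hmem⟩, Subtype.ext ?_⟩
  push_cast
  rw [← mul_assoc, ← C_eq_natCast, ← C_mul, mul_inv_cancel₀ hp0, C_1, one_mul]

theorem not_isUnit_natCast (p : Nat.Primes) : ¬ IsUnit ((p : ℕ) : ringR τ) := by
  rintro ⟨u, hu⟩
  have h : ((p : ℕ) : ringR τ) * ↑u⁻¹ = 1 := by rw [← hu, Units.mul_inv]
  have h' := congrArg (fun f : ringR τ => valueNorm τ p f) h
  simp only [Subring.coe_mul, Subring.coe_natCast, Subring.coe_one] at h'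
  rw [valueNorm_mul, ← C_eq_natCast, ← C_1, valueNorm_C, valueNorm_C, Rat.cast_natCast,
    Rat.cast_one, norm_one, Padic.norm_p] at h'
  have h1 := mem_ringR_iff.1 (u⁻¹ : (ringR τ)ˣ).1.2 p
  have h2 := valueNorm_nonneg τ p (u⁻¹ : (ringR τ)ˣ).1
  have h3 : ((p : ℕ) : ℝ)⁻¹ < 1 := inv_lt_one_of_one_lt₀ (by exact_mod_cast p.2.one_lt)
  exact (mul_lt_one_of_nonneg_of_lt_one_left (by positivity) h3 h1).ne h'

theorem prime_of_irreducible {f : ringR τ} (hf : Irreducible (f : ℚ[X]))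
    (h1 : ∀ p, valueNorm τ p f = 1) : Prime f := by
  have hdvd : ∀ a : ringR τ, (f : ℚ[X]) ∣ a → f ∣ a := by
    rintro a ⟨k, hk⟩
    refine ⟨⟨k, mem_ringR_iff.2 fun p => ?_⟩, Subtype.ext hk⟩
    have := mem_ringR_iff.1 a.2 p
    rwa [hk, valueNorm_mul, h1, one_mul] at this
  refine ⟨fun h => hf.ne_zero (by rw [h]; rfl), fun h => ?_, fun a b h => ?_⟩
  · exact hf.natDegree_pos.ne' (natDegree_eq_zero_of_isUnit h)
  · exact (hf.prime.dvd_or_dvd (map_dvd (ringR τ).subtype h)).imp (hdvd a) (hdvd b)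

theorem valueNorm_eq_one_of_prime {f : ringR τ} (hf : Prime f) (hdeg : 0 < (f : ℚ[X]).natDegree)
    (p : Nat.Primes) : valueNorm τ p f = 1 := by
  by_contra h
  obtain ⟨g, hg⟩ := exists_eq_natCast_mul (lt_of_le_of_ne (mem_ringR_iff.1 f.2 p) h)
  rcases hf.irreducible.isUnit_or_isUnit hg with hu | hu
  · exact not_isUnit_natCast p hu
  · have hg0 := natDegree_eq_zero_of_isUnit hu
    rw [hg, Subring.coe_mul, Subring.coe_natCast, ← C_eq_natCast] at hdeg
    exact (hdeg.trans_le natDegree_mul_le).ne' (by rw [natDegree_C, hg0])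

theorem IsAlmostUnit.irreducible_of_prime (hτ : IsAlmostUnit τ) {f : ringR τ} (hf : Prime f)
    (hdeg : 0 < (f : ℚ[X]).natDegree) : Irreducible (f : ℚ[X]) := by
  have hf0 : (f : ℚ[X]) ≠ 0 := ne_zero_of_natDegree_gt hdeg
  refine ⟨fun h => hdeg.ne' (Polynomial.natDegree_eq_zero_of_isUnit h), fun a b hab => ?_⟩
  have ha : a ≠ 0 := fun h => hf0 (by rw [hab, h, zero_mul])
  have hb : b ≠ 0 := fun h => hf0 (by rw [hab, h, mul_zero])
  obtain ⟨c, hc, hca⟩ := hτ.exists_normalized ha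
  -- Since `C c * a` and `f` have unit values, so has the complementary factor.
  have hcb : ∀ p, valueNorm τ p (C c⁻¹ * b) = 1 := fun p => by
    have h : (f : ℚ[X]) = (C c * a) * (C c⁻¹ * b) := by
      rw [hab, mul_mul_mul_comm, ← C_mul, mul_inv_cancel₀ hc, C_1, one_mul]
    have := valueNorm_eq_one_of_prime hf hdeg p
    rwa [h, valueNorm_mul, hca, one_mul] at this
  have hfab : f = (⟨C c * a, mem_ringR_iff.2 fun p => (hca p).le⟩ : ringR τ) *
      ⟨C c⁻¹ * b, mem_ringR_iff.2 fun p => (hcb p).le⟩ := Subtype.ext (by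
    rw [Subring.coe_mul, hab, mul_mul_mul_comm, ← C_mul, mul_inv_cancel₀ hc, C_1, one_mul])
  exact (hf.irreducible.isUnit_or_isUnit hfab).imp
    (fun h => isUnit_of_mul_isUnit_right (h.map (ringR τ).subtype))
    (fun h => isUnit_of_mul_isUnit_right (h.map (ringR τ).subtype))

/-! ### `R_τ` is a principal ideal domain -/

theorem exists_eq_natCast_add_prime_mul (p : Nat.Primes) (f : ringR τ) :
    ∃ (n : ℕ) (g : ringR τ), f = n + ((p : ℕ) : ringR τ) * g := by
  obtain ⟨x, hx⟩ : ∃ x : ℤ_[(p : ℕ)], (x : ℚ_[(p : ℕ)]) =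
      aeval (R := ℚ) ((τ p : ℤ_[(p : ℕ)]) : ℚ_[(p : ℕ)]) (f : ℚ[X]) :=
    ⟨⟨_, (mem_ringR τ f).1 f.2 p⟩, rfl⟩
  obtain ⟨n, -, hn⟩ := PadicInt.exists_mem_range x
  obtain ⟨g, hg⟩ := exists_eq_natCast_mul (p := p) (f := f - (n : ringR τ)) (by
    have h := PadicInt.mem_nonunits.1 ((IsLocalRing.mem_maximalIdeal _).1 hn)
    rw [PadicInt.norm_def, PadicInt.coe_sub, PadicInt.coe_natCast, hx] at h
    unfold valueNorm
    rw [AddSubgroupClass.coe_sub, Subring.coe_natCast, map_sub, map_natCast]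
    exact h)
  exact ⟨n, g, by rw [← hg, add_sub_cancel]⟩

/-- The quotient of `R_τ` by a positive integer `m` is `ℤ/mℤ`. -/
theorem exists_eq_intCast_add_natCast_mul {m : ℕ} (hm : m ≠ 0) (f : ringR τ) :
    ∃ (t : ℤ) (g : ringR τ), f = t + m * g := by
  induction m using induction_on_primes generalizing f with
  | zero => exact absurd rfl hm
  | one => exact ⟨0, f, by simp⟩
  | prime_mul p a hp ih =>
    obtain ⟨n, g, hg⟩ := exists_eq_natCast_add_prime_mul ⟨p, hp⟩ f
    obtain ⟨t, k, rfl⟩ := ih (right_ne_zero_of_mul hm) g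
    refine ⟨n + p * t, k, ?_⟩
    rw [hg]
    push_cast
    ring

/-- A nonzero ideal is generated by `m * f`, where `f` is the normalized generator of its extension
to `ℚ[x]` and `m` is the least positive integer with `m * f` in the ideal. -/
theorem IsAlmostUnit.isPrincipalIdealRing (hτ : IsAlmostUnit τ) :
    IsPrincipalIdealRing (ringR τ) := by
  classical
  refine ⟨fun I => ?_⟩
  by_cases hI : I = ⊥
  · exact hI ▸ bot_isPrincipal
  have hex : ∃ n, ∃ a ∈ I, a ≠ 0 ∧ (a : ℚ[X]).natDegree = n := by
    obtain ⟨a, ha, ha0⟩ := Submodule.exists_mem_ne_zero_of_ne_bot hI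
    exact ⟨_, a, ha, ha0, rfl⟩
  obtain ⟨a, haI, ha0, han⟩ := Nat.find_spec hex
  have hmin : ∀ b ∈ I, b ≠ 0 → (a : ℚ[X]).natDegree ≤ (b : ℚ[X]).natDegree := fun b hb hb0 => by
    rw [han]
    exact Nat.find_min' hex ⟨b, hb, hb0, rfl⟩
  have ha0' : (a : ℚ[X]) ≠ 0 := fun h => ha0 (Subtype.ext h)
  obtain ⟨c, hc, hca⟩ := hτ.exists_normalized ha0'
  set f : ringR τ := ⟨C c * a, mem_ringR_iff.2 fun p => (hca p).le⟩ with hf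
  have hf0 : (f : ℚ[X]) ≠ 0 := mul_ne_zero (C_ne_zero.2 hc) ha0'
  have hfa : C c⁻¹ * (f : ℚ[X]) = a := by
    rw [hf]
    dsimp only
    rw [← mul_assoc, ← C_mul, inv_mul_cancel₀ hc, C_1, one_mul]
  obtain ⟨b, hb⟩ := exists_int_eq_of_norm_le_one (c := c⁻¹) fun p => by
    have h := mem_ringR_iff.1 a.2 p
    rwa [← hfa, valueNorm_mul, hca, mul_one, valueNorm_C] at h
  have hb0 : b ≠ 0 := fun h => inv_ne_zero hc (by rw [hb, h, Int.cast_zero])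
  have hbf : (b : ringR τ) * f = a := Subtype.ext (by
    rw [Subring.coe_mul, Subring.coe_intCast, ← C_eq_intCast, ← hb, hfa])
  have hdeg : (a : ℚ[X]).degree = (f : ℚ[X]).degree := by
    rw [hf]
    dsimp only
    rw [degree_C_mul hc]
  -- Every element of `I` is a multiple of `f` in `ℚ[x]`, hence in `R_τ`.
  have hdvd : ∀ y ∈ I, ∃ k : ringR τ, y = f * k := by
    intro y hy
    have hr : (y : ℚ[X]) % f = 0 := by
      by_contra hr0
      obtain ⟨m, hm, u, hu⟩ := exists_map_eq_C_mul ((y : ℚ[X]) / f)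
      set z : ringR τ := ((m * b : ℤ) : ringR τ) * y - ⟨_, map_mem_ringR τ u⟩ * a with hz
      have hzI : z ∈ I := I.sub_mem (I.mul_mem_left _ hy) (I.mul_mem_left _ haI)
      have hmb : ((m * b : ℤ) : ℚ) ≠ 0 := by exact_mod_cast mul_ne_zero hm hb0
      have hzr : (z : ℚ[X]) = C ((m * b : ℤ) : ℚ) * ((y : ℚ[X]) % f) := by
        rw [hz, AddSubgroupClass.coe_sub, Subring.coe_mul, Subring.coe_mul, Subring.coe_intCast]
        change _ - u.map (Int.castRingHom ℚ) * (a : ℚ[X]) = _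
        rw [hu, ← hfa, hb, ← C_eq_intCast]
        have h := EuclideanDomain.div_add_mod (y : ℚ[X]) f
        push_cast
        rw [C_mul]
        linear_combination (-(C (m : ℚ) * C (b : ℚ))) * h
      have hz0 : z ≠ 0 := fun h => by
        rw [h, Subring.coe_zero, eq_comm, mul_eq_zero, C_eq_zero] at hzr
        exact hzr.elim hmb hr0
      have h1 := hmin z hzI hz0
      rw [hzr, natDegree_C_mul hmb] at h1
      refine h1.not_gt (natDegree_lt_natDegree hr0 ?_)
      rw [hdeg]
      exact EuclideanDomain.mod_lt _ hf0
    obtain ⟨k, hk⟩ := (EuclideanDomain.mod_eq_zero.1 hr : (f : ℚ[X]) ∣ y)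
    refine ⟨⟨k, mem_ringR_iff.2 fun p => ?_⟩, Subtype.ext hk⟩
    have := mem_ringR_iff.1 y.2 p
    rwa [hk, valueNorm_mul, hca, one_mul] at this
  let J : Ideal ℤ :=
    { carrier := {m | (m : ringR τ) * f ∈ I}
      add_mem' := fun {x y} hx hy => by
        have := I.add_mem hx hy
        rwa [← add_mul, ← Int.cast_add] at this
      zero_mem' := by simp
      smul_mem' := fun x y hy => by
        have := I.mul_mem_left (x : ringR τ) hy
        rwa [← mul_assoc, ← Int.cast_mul] at this }
  obtain ⟨m, hm⟩ := IsPrincipalIdealRing.principal J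
  have hJ : ∀ x : ℤ, (x : ringR τ) * f ∈ I ↔ m ∣ x := fun x => by
    rw [← Ideal.mem_span_singleton, Ideal.span, ← hm]
    rfl
  have hm0 : m ≠ 0 := fun h => hb0 (zero_dvd_iff.1 (h ▸ (hJ b).1 (hbf ▸ haI)))
  refine ⟨(m : ringR τ) * f, le_antisymm (fun y hy => ?_) ?_⟩
  · obtain ⟨k, rfl⟩ := hdvd y hy
    obtain ⟨t, k', hk⟩ := exists_eq_intCast_add_natCast_mul (Int.natAbs_ne_zero.2 hm0) k
    have hmn : m ∣ (m.natAbs : ℤ) := Int.dvd_natAbs_self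
    have hmem : ((m.natAbs : ℤ) : ringR τ) * f ∈ I := (hJ _).2 hmn
    obtain ⟨s, hs⟩ : m ∣ t := by
      rw [← hJ]
      have := I.sub_mem hy (I.mul_mem_left k' hmem)
      convert this using 1
      rw [hk, Int.cast_natCast]
      ring
    obtain ⟨w, hw⟩ := hmn
    refine Ideal.mem_span_singleton.2 ⟨s + w * k', ?_⟩
    have hw' : ((m.natAbs : ℕ) : ringR τ) = m * w := by
      rw [← Int.cast_natCast, hw, Int.cast_mul]
    rw [hk, hs, hw', Int.cast_mul]
    ring
  · exact (Ideal.span_singleton_le_iff_mem I).2 ((hJ m).2 dvd_rfl)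

end

/-! ### Profinite integers with prescribed residues -/

theorem exists_transcendental_near (p : ℕ) [Fact p.Prime] (r : ℤ) :
    ∃ x : ℤ_[p], ‖x - r‖ < 1 ∧ Transcendental ℚ (x : ℚ_[p]) := by
  obtain ⟨x, hx, hxr⟩ := ((Algebraic.countable ℚ ℚ_[p]).dense_compl ℚ_[p]).exists_mem_open
    Metric.isOpen_ball (Metric.nonempty_ball.2 one_pos : (Metric.ball (r : ℚ_[p]) 1).Nonempty)
  rw [mem_ball_iff_norm] at hxr
  have hx1 : ‖x‖ ≤ 1 := by
    rw [← sub_add_cancel x (r : ℚ_[p])]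
    exact (Padic.nonarchimedean _ _).trans (max_le hxr.le (Padic.norm_int_le_one r))
  obtain ⟨y, rfl⟩ : ∃ y : ℤ_[p], (y : ℚ_[p]) = x := ⟨⟨x, hx1⟩, rfl⟩
  refine ⟨y, ?_, hx⟩
  rw [PadicInt.norm_def, PadicInt.coe_sub, PadicInt.coe_intCast]
  exact hxr

/-- `τ` is transcendental at each prime and has the residues that are fixed by the tower. -/
structure Tower.IsLimit {D : Set (List ℕ)} (T : Tower D) (τ : ProfiniteInt) : Prop where
  norm_sub_lt_one : ∀ p : Nat.Primes, ‖τ p - ((T.stage p).residue p : ℤ)‖ < 1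
  transcendental : ∀ p : Nat.Primes, Transcendental ℚ ((τ p : ℤ_[(p : ℕ)]) : ℚ_[(p : ℕ)])

theorem Tower.exists_isLimit {D : Set (List ℕ)} (T : Tower D) : ∃ τ, T.IsLimit τ := by
  choose x hx hx' using fun p : Nat.Primes =>
    exists_transcendental_near (p : ℕ) ((T.stage p).residue p)
  exact ⟨x, hx, hx'⟩

theorem eventually_lt_prime (B : ℕ) : ∀ᶠ p : Nat.Primes in Filter.cofinite, B < p := by
  rw [Filter.eventually_cofinite]
  refine ((Set.finite_Iic B).preimage Subtype.val_injective.injOn).subset fun p hp => ?_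
  exact not_lt.1 hp

theorem eventually_valueNorm_le_one (τ : ProfiniteInt) (q : ℚ[X]) :
    ∀ᶠ p in Filter.cofinite, valueNorm τ p q ≤ 1 := by
  obtain ⟨b, hb, u, hu⟩ := exists_map_eq_C_mul q
  filter_upwards [eventually_lt_prime b.natAbs] with p hp
  have h1 : ‖((b : ℚ) : ℚ_[(p : ℕ)])‖ = 1 := by
    rw [Rat.cast_intCast]
    refine le_antisymm (Padic.norm_int_le_one b) (not_lt.1 fun h => ?_)
    exact (Nat.le_of_dvd (Int.natAbs_pos.2 hb)
      (Int.natCast_dvd.1 (Padic.norm_intCast_lt_one_iff.1 h))).not_gt hp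
  have h2 := valueNorm_map_le_one τ p u
  rwa [hu, valueNorm_mul, valueNorm_C, h1, one_mul] at h2

theorem eventually_valueNorm_eq_one_of_dvd {τ : ProfiniteInt} {q r : ℚ[X]} (h : q ∣ r)
    (hr : ∀ᶠ p in Filter.cofinite, valueNorm τ p r = 1) :
    ∀ᶠ p in Filter.cofinite, valueNorm τ p q = 1 := by
  obtain ⟨k, rfl⟩ := h
  filter_upwards [hr, eventually_valueNorm_le_one τ q, eventually_valueNorm_le_one τ k]
    with p h1 h2 h3
  rw [valueNorm_mul] at h1
  exact le_antisymm h2 (h1.ge.trans (mul_le_of_le_one_right (valueNorm_nonneg τ p q) h3))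

/-- Irreducible polynomials over `ℚ` that divide each other differ by a constant. -/
theorem exists_eq_C_mul_of_dvd {q r : ℚ[X]} (hq : Irreducible q) (hr : Irreducible r)
    (h : q ∣ r) : ∃ c : ℚ, c ≠ 0 ∧ q = C c * r := by
  obtain ⟨u, hu⟩ := (hq.associated_of_dvd hr h).symm
  obtain ⟨c, hc, hcu⟩ := Polynomial.isUnit_iff.1 u.isUnit
  exact ⟨c, hc.ne_zero, by rw [← hu, ← hcu, mul_comm]⟩

section

variable {D : Set (List ℕ)} (T : Tower D)

theorem Tower.exists_dvd_poly {q : ℚ[X]} (hq : Irreducible q) :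
    ∃ N, q ∣ (T.stage N).poly.map (Int.castRingHom ℚ) := by
  obtain ⟨c, hc, g, rfl⟩ := exists_eq_C_mul_map q
  have hCc : IsUnit (C c : ℚ[X]) := isUnit_C.2 hc.isUnit
  have hg := (irreducible_isUnit_mul hCc).1 hq
  simp only [hCc.mul_left_dvd]
  have h := T.stepSpec (T.task.symm (.inl g))
  rw [T.task.apply_symm_apply] at h
  rcases h with h | h
  · exact ⟨_, h.2 hg⟩
  · exact ⟨_, by rw [h.poly_eq, Polynomial.map_mul]; exact dvd_mul_left _ _⟩

/-- Each irreducible polynomial over `ℚ` is treated, up to a constant factor, at the first stage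
after which it divides the product. -/
theorem Tower.exists_task {q : ℚ[X]} (hq : Irreducible q) :
    ∃ (N : ℕ) (g : ℤ[X]) (c : ℚ), c ≠ 0 ∧ q = C c * g.map (Int.castRingHom ℚ) ∧
      g ∣ (T.stage (N + 1)).poly ∧
      ((T.task N = .inl g ∧ IsSeparatingStep (T.stage N) (T.stage (N + 1)) g) ∨
        ∃ d ∈ D, ∃ n, IsProgressionStep (T.stage N) (T.stage (N + 1)) d n (T.start d n) ∧
          T.task N = .inr (d, n) ∧ ∃ e ∈ 0 :: d, g = T.start d n + C (e : ℤ)) := by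
  classical
  have hex := T.exists_dvd_poly hq
  obtain ⟨N, hN⟩ : ∃ N, Nat.find hex = N + 1 := Nat.exists_eq_succ_of_ne_zero fun h => by
    have := Nat.find_spec hex
    rw [h, T.poly_zero, Polynomial.map_one] at this
    exact hq.not_isUnit (isUnit_of_dvd_one this)
  have h1 := Nat.find_spec hex
  rw [hN] at h1
  have h0 : ¬ q ∣ (T.stage N).poly.map (Int.castRingHom ℚ) := Nat.find_min hex (by omega)
  have hspec := T.stepSpec N
  rcases ht : T.task N with g | ⟨d, n⟩
  · rw [ht] at hspec
    rcases hspec with h | h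
    · exact absurd (h.1 ▸ h1) h0
    · rw [h.poly_eq, Polynomial.map_mul] at h1
      obtain ⟨c, hc, hqc⟩ :=
        exists_eq_C_mul_of_dvd hq h.irreducible ((hq.prime.dvd_or_dvd h1).resolve_left h0)
      exact ⟨N, g, c, hc, hqc, h.poly_eq ▸ dvd_mul_left _ _, .inl ⟨ht, h⟩⟩
  · rw [ht] at hspec
    rcases hspec with h | ⟨hd, -⟩
    · exact absurd (h.1 ▸ h1) h0
    · have h := T.isProgressionStep d hd n N ht
      rw [h.poly_eq, Polynomial.map_mul, Polynomial.map_prod] at h1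
      obtain ⟨e, he, hqe⟩ :=
        hq.prime.exists_mem_finset_dvd ((hq.prime.dvd_or_dvd h1).resolve_left h0)
      obtain ⟨c, hc, hqc⟩ := exists_eq_C_mul_of_dvd hq (h.irreducible e (List.mem_toFinset.1 he)) hqe
      refine ⟨N, _, c, hc, hqc, ?_, .inr ⟨d, hd, n, h, ht, e, List.mem_toFinset.1 he, rfl⟩⟩
      rw [h.poly_eq]
      exact (Finset.dvd_prod_of_mem (fun e : ℕ => T.start d n + C (e : ℤ)) he).mul_left _

variable {T} {τ : ProfiniteInt} (hτ : T.IsLimit τ)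
include hτ

theorem Tower.IsLimit.norm_sub_stage_lt_one {N : ℕ} {p : Nat.Primes}
    (hp : (p : ℕ) ≤ (T.stage N).bound) : ‖τ p - ((T.stage N).residue p : ℤ)‖ < 1 := by
  rw [← residue_self_eq T.stage_extends hp]
  exact hτ.norm_sub_lt_one p

theorem Tower.IsLimit.valueNorm_poly {N : ℕ} {p : Nat.Primes} (hp : (T.stage N).bound < p) :
    valueNorm τ p ((T.stage N).poly.map (Int.castRingHom ℚ)) = 1 :=
  le_antisymm (valueNorm_map_le_one τ p _) (not_lt.1 fun h =>
    not_dvd_eval_residue T.stage_extends p.2 hp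
      ((valueNorm_map_lt_one_iff τ p (hτ.norm_sub_lt_one p) _).1 h))

theorem Tower.IsLimit.isAlmostUnit : IsAlmostUnit τ := by
  have hpoly : ∀ N, ∀ᶠ p in Filter.cofinite,
      valueNorm τ p ((T.stage N).poly.map (Int.castRingHom ℚ)) = 1 := fun N => by
    filter_upwards [eventually_lt_prime (T.stage N).bound] with p hp
    exact hτ.valueNorm_poly hp
  refine ⟨fun p q hq h => hτ.transcendental p ⟨q, hq, norm_eq_zero.1 h⟩, fun q hq => ?_⟩
  change ∀ᶠ p in Filter.cofinite, valueNorm τ p q = 1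
  induction q using WfDvdMonoid.induction_on_irreducible with
  | zero => exact absurd rfl hq
  | unit u hu => exact eventually_valueNorm_eq_one_of_dvd hu.dvd (hpoly 0)
  | mul a i ha hi ih =>
    obtain ⟨N, hN⟩ := T.exists_dvd_poly hi
    filter_upwards [ih ha, eventually_valueNorm_eq_one_of_dvd hN (hpoly N)] with p h1 h2
    rw [valueNorm_mul, h1, h2, one_mul]

theorem Tower.IsLimit.valueNorm_progression {d : List ℕ} {n N : ℕ} {F : ℤ[X]}
    (h : IsProgressionStep (T.stage N) (T.stage (N + 1)) d n F) {e : ℕ} (he : e ∈ 0 :: d)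
    (p : Nat.Primes) : valueNorm τ p ((F + C (e : ℤ)).map (Int.castRingHom ℚ)) = 1 := by
  refine le_antisymm (valueNorm_map_le_one τ p _) (not_lt.1 fun hlt => ?_)
  rw [valueNorm_map_lt_one_iff τ p (hτ.norm_sub_lt_one p)] at hlt
  rcases le_or_gt (p : ℕ) (T.stage (N + 1)).bound with hp | hp
  · exact h.not_dvd e he p p.2 hp _ hlt
  · refine not_dvd_eval_residue T.stage_extends p.2 hp (hlt.trans (eval_dvd ?_))
    rw [h.poly_eq]
    exact (Finset.dvd_prod_of_mem (fun e : ℕ => F + C (e : ℤ)) (List.mem_toFinset.2 he)).mul_left _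

/-- Normalized multiples of a polynomial treated by a separating step and of one treated before have
different leading coefficients: at the prime of the separating step, the former has norm greater
than `1`, and the latter has norm `1`. -/
theorem Tower.IsLimit.leadingCoeff_ne {N : ℕ} {g h : ℤ[X]} {c c' : ℚ}
    (hg : IsSeparatingStep (T.stage N) (T.stage (N + 1)) g) (hh : h ∣ (T.stage N).poly)
    (hg1 : ∀ p, valueNorm τ p (C c * g.map (Int.castRingHom ℚ)) = 1)
    (hh1 : ∀ p, valueNorm τ p (C c' * h.map (Int.castRingHom ℚ)) = 1) :
    (C c * g.map (Int.castRingHom ℚ)).leadingCoeff ≠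
      (C c' * h.map (Int.castRingHom ℚ)).leadingCoeff := by
  obtain ⟨p, hp, hlt, hle, hlcg, hlcQ, hroot⟩ := hg.exists_prime
  obtain ⟨p, rfl⟩ : ∃ q : Nat.Primes, (q : ℕ) = p := ⟨⟨p, hp⟩, rfl⟩
  have hunit : ∀ z : ℤ, ¬ ((p : ℕ) : ℤ) ∣ z → ‖(z : ℚ_[(p : ℕ)])‖ = 1 := fun z hz =>
    le_antisymm (Padic.norm_int_le_one z) (not_lt.1 fun h => hz (Padic.norm_intCast_lt_one_iff.1 h))
  have h1 := hg1 p
  have h2 := hh1 p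
  rw [valueNorm_mul, valueNorm_C] at h1 h2
  have hgp : valueNorm τ p (g.map (Int.castRingHom ℚ)) < 1 :=
    (valueNorm_map_lt_one_iff τ p (hτ.norm_sub_stage_lt_one hle) g).2 hroot
  have hhp : valueNorm τ p (h.map (Int.castRingHom ℚ)) = 1 := by
    refine le_antisymm (valueNorm_map_le_one τ p _) (not_lt.1 fun hlt' => ?_)
    rw [valueNorm_map_lt_one_iff τ p (hτ.norm_sub_lt_one p)] at hlt'
    exact not_dvd_eval_residue T.stage_extends p.2 hlt (hlt'.trans (eval_dvd hh))
  rw [hhp, mul_one] at h2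
  intro heq
  rw [leadingCoeff_mul, leadingCoeff_mul, leadingCoeff_C, leadingCoeff_C,
    leadingCoeff_map_of_injective Int.cast_injective,
    leadingCoeff_map_of_injective Int.cast_injective, eq_intCast, eq_intCast] at heq
  have h3 := congrArg (fun x : ℚ => ‖(x : ℚ_[(p : ℕ)])‖) heq
  simp only [Rat.cast_mul, Rat.cast_intCast, norm_mul] at h3
  rw [hunit _ hlcg, hunit _ fun h => hlcQ (h.trans (leadingCoeff_dvd_leadingCoeff hh)), h2,
    mul_one, mul_one] at h3
  rw [h3, one_mul] at h1
  exact hgp.ne h1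

/-- A prime treated by a separating step is not a translate by an integer of another prime. -/
theorem Tower.IsLimit.not_exists_prime_translate {f : ringR τ} (hf : Prime f)
    (hdeg : 0 < (f : ℚ[X]).natDegree) {N : ℕ} {g : ℤ[X]} {c : ℚ}
    (hfg : (f : ℚ[X]) = C c * g.map (Int.castRingHom ℚ)) (hg : T.task N = .inl g)
    (hg' : IsSeparatingStep (T.stage N) (T.stage (N + 1)) g) :
    ¬ ∃ h : ringR τ, Prime h ∧ h ≠ f ∧ ∃ z : ℤ, f - h = (z : ringR τ) := by
  rintro ⟨h, hh, hne, z, hz⟩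
  have hτ' := hτ.isAlmostUnit
  have hfh : (f : ℚ[X]) = h + C (z : ℚ) := by
    have : f = h + (z : ringR τ) := by rw [← hz, add_sub_cancel]
    rw [this, Subring.coe_add, Subring.coe_intCast, C_eq_intCast]
  have hnd : (f : ℚ[X]).natDegree = (h : ℚ[X]).natDegree := by rw [hfh, natDegree_add_C]
  have hdegh : 0 < (h : ℚ[X]).natDegree := hnd ▸ hdeg
  have hlc : (f : ℚ[X]).leadingCoeff = (h : ℚ[X]).leadingCoeff := by
    rw [leadingCoeff, hnd, hfh, coeff_add, coeff_C, if_neg hdegh.ne', add_zero, leadingCoeff]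
  have hf1 := valueNorm_eq_one_of_prime hf hdeg
  have hh1 := valueNorm_eq_one_of_prime hh hdegh
  obtain ⟨M, k, c', hc', hhk, hkM, hk⟩ := T.exists_task (hτ'.irreducible_of_prime hh hdegh)
  rw [hfg] at hf1 hlc
  rw [hhk] at hh1 hlc
  have hc : c ≠ 0 := fun h0 => by
    rw [hfg, h0, C_0, zero_mul, natDegree_zero] at hdeg
    exact lt_irrefl _ hdeg
  rcases lt_trichotomy M N with hMN | rfl | hNM
  · exact hτ.leadingCoeff_ne hg' (hkM.trans (poly_dvd T.stage_extends hMN)) hf1 hh1 hlc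
  · rcases hk with ⟨hk, -⟩ | ⟨d, -, n, -, hk, -⟩
    · obtain rfl : g = k := by simpa [hg] using hk
      rw [leadingCoeff_mul, leadingCoeff_mul, leadingCoeff_C, leadingCoeff_C] at hlc
      have hg0 : (g.map (Int.castRingHom ℚ)).leadingCoeff ≠ 0 :=
        leadingCoeff_ne_zero.2 hg'.irreducible.ne_zero
      rw [mul_right_cancel₀ hg0 hlc] at hfg
      exact hne (Subtype.ext (hhk.trans hfg.symm))
    · simp [hg] at hk
  · have hgM : g ∣ (T.stage M).poly :=
      (hg'.poly_eq ▸ dvd_mul_left g _ : g ∣ (T.stage (N + 1)).poly).trans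
        (poly_dvd T.stage_extends hNM)
    rcases hk with ⟨-, hk⟩ | ⟨d, -, n, hk, -, e, -, rfl⟩
    · exact hτ.leadingCoeff_ne hk hgM hh1 hf1 hlc.symm
    -- A progression has larger degree than everything that was treated before.
    · have h1 := natDegree_le_of_dvd hgM (T.poly_ne_zero M)
      have h2 := hk.natDegree_lt
      rw [hfg, hhk, natDegree_C_mul hc, natDegree_C_mul hc',
        natDegree_map_eq_of_injective Int.cast_injective,
        natDegree_map_eq_of_injective Int.cast_injective, natDegree_add_C] at hnd
      omega

end

end ProfinitePID

/-! ### Choice of the progressions -/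

open ProfinitePID in
theorem theorem4p3 (D : Set (List ℕ)) (hD : D ⊆ ProfinitePID.AdmissibleSeq) :
    ∃ τ : ProfinitePID.ProfiniteInt,
      (IsDomain (ProfinitePID.ringR τ) ∧ IsPrincipalIdealRing (ProfinitePID.ringR τ)) ∧
      -- `F d` is the sequence of initial terms of the progressions with differences `d`
      ∃ F : List ℕ → ℕ → ProfinitePID.ringR τ,
        (∀ d ∈ D,
          (∀ n : ℕ, ProfinitePID.IsPrimeProgression (F d n) d) ∧
          ∀ b : ProfinitePID.ringR τ, ∃ n : ℕ, ProfinitePID.OrdLE b (F d n)) ∧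
        ∀ g : ProfinitePID.ringR τ,
          ProfinitePID.IsNonstandardPrime g → ProfinitePID.IsPositive g →
            (∃ d ∈ D, ∃ n : ℕ, g ∈ ProfinitePID.progression (F d n) d) ∨
            ¬ ∃ h : ProfinitePID.ringR τ, Prime h ∧ h ≠ g ∧ ∃ z : ℤ, g - h = (z : ProfinitePID.ringR τ) := by
  obtain ⟨T⟩ := nonempty_tower hD
  obtain ⟨τ, hτ⟩ := T.exists_isLimit
  have hτ' := hτ.isAlmostUnit
  let F : List ℕ → ℕ → ringR τ := fun d n => ⟨_, map_mem_ringR τ (T.start d n)⟩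
  have hFe : ∀ d n (e : ℕ), ((F d n + (e : ringR τ) : ringR τ) : ℚ[X]) =
      (T.start d n + C (e : ℤ)).map (Int.castRingHom ℚ) := fun d n e => by
    rw [Subring.coe_add, Subring.coe_natCast, Polynomial.map_add, map_C, eq_intCast,
      Int.cast_natCast, C_eq_natCast]
  have hstep : ∀ d ∈ D, ∀ n, ∃ N,
      IsProgressionStep (T.stage N) (T.stage (N + 1)) d n (T.start d n) := fun d hd n =>
    ⟨_, T.isProgressionStep d hd n _ (T.task.apply_symm_apply _)⟩
  have hlc : ∀ d ∈ D, ∀ n, ∀ e : ℕ,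
      0 < ((T.start d n + C (e : ℤ)).map (Int.castRingHom ℚ)).leadingCoeff := fun d hd n e => by
    obtain ⟨N, h⟩ := hstep d hd n
    have hpos : 0 < (T.start d n).natDegree := h.natDegree_lt.pos
    rw [leadingCoeff_map_of_injective Int.cast_injective, eq_intCast, leadingCoeff,
      natDegree_add_C, coeff_add, coeff_C, if_neg hpos.ne', add_zero]
    exact_mod_cast h.leadingCoeff_pos
  refine ⟨τ, ⟨inferInstance, hτ'.isPrincipalIdealRing⟩, F, fun d hd => ⟨fun n => ?_, fun b => ?_⟩,
    fun g hg hpos => ?_⟩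
  · rintro _ ⟨e, he, rfl⟩
    obtain ⟨N, h⟩ := hstep d hd n
    exact ⟨prime_of_irreducible (by rw [hFe]; exact h.irreducible e he)
      fun p => by rw [hFe]; exact hτ.valueNorm_progression h he p, by
        rw [IsPositive, hFe]; exact hlc d hd n e⟩
  · set n := (b : ℚ[X]).natDegree + 1 with hn
    refine ⟨n, ?_⟩
    obtain ⟨N, h⟩ := hstep d hd n
    have hlt : (b : ℚ[X]).degree < (F d n : ℚ[X]).degree := by
      refine degree_lt_degree ?_
      change _ < ((T.start d n).map (Int.castRingHom ℚ)).natDegree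
      rw [natDegree_map_eq_of_injective Int.cast_injective]
      have := h.le_natDegree
      omega
    rw [OrdLE, leadingCoeff_sub_of_degree_lt hlt]
    have := hlc d hd n 0
    rw [Nat.cast_zero, C_0, add_zero] at this
    exact this.le
  · obtain ⟨N, k, c, hc, hgk, -, hk⟩ := T.exists_task (hτ'.irreducible_of_prime hg.1 hg.2)
    rcases hk with ⟨ht, hk⟩ | ⟨d, hd, n, hk, -, e, he, rfl⟩
    · exact .inr (hτ.not_exists_prime_translate hg.1 hg.2 hgk ht hk)
    · refine .inl ⟨d, hd, n, e, he, Subtype.ext ?_⟩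
      rw [hFe, hgk]
      -- Both normalized multiples have unit values, hence differ by a sign only.
      have hc1 : c = 1 ∨ c = -1 := eq_one_or_eq_neg_one_of_norm_eq_one fun p => by
        have := valueNorm_eq_one_of_prime hg.1 hg.2 p
        rwa [hgk, valueNorm_mul, hτ.valueNorm_progression hk he, mul_one, valueNorm_C] at this
      rcases hc1 with rfl | rfl
      · rw [C_1, one_mul]
      · rw [IsPositive, hgk, leadingCoeff_mul, leadingCoeff_C] at hpos
        have := hlc d hd n e
        linarith
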